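/- Let $F$ be a distribution function on $\mathbb{R}$ with $1-F(x)=x^{-1/\gamma}L(x)$ for all large $x$, where $\gamma>0$ and $L$ is slowly varying at infinity (measurable, eventually positive, $L(tx)/L(x)\to1$ as $x\to\infty$ for every $t>0$). Let $Q(s)=\inf\{x: F(x)\ge s\}$, $s\in(0,1)$, be the quantile function, let $U$ be uniform on $(0,1)$, and put $$Y(v)=\log\frac{Q(1-Uv)}{Q(1-v)}\quad(0<v<1),\qquad Y(0)=-\gamma\log U .$$ For $p>0$ let $m_p(v)=\mathbf{E}\,Y(v)^p$ and $\sigma_p^2(v)=\mathbf{Var}\,(Y(v)^p)$, with $\sigma_p(v)\ge 0$. For each $v\in[0,1)$ let $Y_1(v),Y_2(v),\dots$ be i.i.d. copies of $Y(v)$, and put $Z_n(p,v)=\sum_{i=1}^nY_i(v)^p$. Let $\alpha\in(2,\infty]$. Then there is $v_0\in(0,1)$ such that $Q(1-v)>0$ for $v\in(0,v_0]$, such that $\mathbf{E}\,Y(v)^q<\infty$ and $\sigma_q(v)>0$ for all $v\in[0,v_0]$ and $q>0$, and such that for every real sequence $p_n\to\infty$ with $$\liminf_{n\to\infty}\frac{\log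 n}{p_n}=\alpha$$ we have $$\frac{Z_n(p_n,v)-n\,m_{p_n}(v)}{\sqrt n\,\sigma_{p_n}(v)}\ \stackrel{\mathcal D}{\longrightarrow}\ N(0,1)\quad\text{uniformly on }[0,v_0],$$ that is, for every $x\in\mathbb{R}$, $$\lim_{n\to\infty}\ \sup_{v\in[0,v_0]}\left|\mathbf{P}\left(\frac{Z_n(p_n,v)-n\,m_{p_n}(v)}{\sqrt n\,\sigma_{p_n}(v)}\le x\right)-\Phi(x)\right|=0,$$ where $\Phi$ is the standard normal distribution function. -/

import Mathlib

open MeasureTheory ProbabilityTheory Filter Topology Set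

noncomputable section

/-- `L` is slowly varying at infinity: measurable, eventually positive, and
`L (t * x) / L x → 1` as `x → ∞` for every `t > 0`. -/
def IsSlowlyVarying (L : ℝ → ℝ) : Prop :=
  Measurable L ∧ (∀ᶠ x in atTop, 0 < L x) ∧
    ∀ t : ℝ, 0 < t → Tendsto (fun x => L (t * x) / L x) atTop (𝓝 1)

/-- The quantile function `Q(s) = inf {x : F(x) ≥ s}`, used for `s ∈ (0,1)`. -/
def quantile (F : ℝ → ℝ) (s : ℝ) : ℝ := sInf {x : ℝ | s ≤ F x}

/-- The uniform distribution on `(0,1)`, i.e. the law of `U`. -/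
def unif : Measure ℝ := volume.restrict (Ioo (0 : ℝ) 1)

/-- The variable `Y(v)` as a function of the value `u` of the uniform variable `U`:
`Y(v) = log (Q(1 - U v) / Q(1 - v))` for `v ∈ (0,1)`, and `Y(0) = - γ log U`. -/
def Yvar (F : ℝ → ℝ) (γ v u : ℝ) : ℝ :=
  if v = 0 then -γ * Real.log u
  else Real.log (quantile F (1 - u * v) / quantile F (1 - v))

/-- `m_p(v) = E Y(v)^p`. -/
def mMoment (F : ℝ → ℝ) (γ p v : ℝ) : ℝ := ∫ u, Yvar F γ v u ^ p ∂unif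

/-- `σ_p(v)`, the standard deviation of `Y(v)^p`. -/
def sigmaMoment (F : ℝ → ℝ) (γ p v : ℝ) : ℝ :=
  Real.sqrt (variance (fun u => Yvar F γ v u ^ p) unif)

/-- `Z_n(p,v) = ∑_{i=1}^n Y_i(v)^p`; here `Y v i` stands for `Y_{i+1}(v)`. -/
def Zsum {Ω : Type*} (Y : ℝ → ℕ → Ω → ℝ) (n : ℕ) (p v : ℝ) (ω : Ω) : ℝ :=
  ∑ i ∈ Finset.range n, Y v i ω ^ p

end

/-! With `E = -log U` exponential, regular variation of the tail makes `Y(v)` nearly `γ E`: for any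
`b < γ < a`, if `v₀` is small, `b E - 1 ≤ Y(v) ≤ a E + 1` for all `v ≤ v₀` (`exists_Yvar_bounds`).
Hence `E Y^q` is of order `(γ q / e)^q` up to a factor exponential in `q` with rate as small as
desired. Lyapunov's condition of order `s > 2` needs `E Y^{sp} / (E Y^{2p})^{s/2}` to be negligible
against `n^{(s-2)/2}`. The ratio grows about like `(s/2)^{sp}`, while `n ≥ exp(β p)` eventually for
any `β < α`. So `s log(s/2) < β (s-2)/2` suffices, and for `s` slightly above 2 this holds as soon
as `β > 2` (`exists_rate_parameters`). The bounds are uniform in `v`, so the CLT holds along every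
sequence `v = w n`, and near-maximizers turn this into uniform convergence. -/

/-! ### Lyapunov's CLT with a fractional moment. -/

/-- For `|y| ≤ 1` the cubic remainder is at most a multiple of `|y|^s` because `s ≤ 3`; for `|y| ≥
1` every term is dominated by `|y|^s` because `s ≥ 2`. Exponents near 2 are what the threshold `α >
2` requires. -/
lemma norm_exp_I_mul_sub_taylor_two_le {s : ℝ} (hs : 2 ≤ s) (hs3 : s ≤ 3) (y : ℝ) :
    ‖Complex.exp (y * Complex.I) - (1 + y * Complex.I - (y : ℂ) ^ 2 / 2)‖ ≤ 4 * |y| ^ s := by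
  have hyn : ‖(y : ℂ) * Complex.I‖ = |y| := by simp
  rcases le_total |y| 1 with h | h
  · have := Complex.exp_bound (x := (y : ℂ) * Complex.I) (by rw [hyn]; exact h) (n := 3) (by norm_num)
    rw [hyn] at this
    have e : ∑ m ∈ Finset.range 3, ((y : ℂ) * Complex.I) ^ m / (m.factorial : ℂ)
        = 1 + y * Complex.I - (y : ℂ) ^ 2 / 2 := by
      simp [Finset.sum_range_succ, mul_pow]; ring
    rw [e] at this
    refine this.trans ?_
    have h1 : |y| ^ 3 ≤ |y| ^ s := by
      rcases eq_or_lt_of_le (abs_nonneg y) with h0 | h0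
      · rw [← h0, Real.zero_rpow (by linarith)]; norm_num
      · rw [← Real.rpow_natCast]
        exact Real.rpow_le_rpow_of_exponent_ge h0 h (by exact_mod_cast hs3)
    have h2 : (0 : ℝ) ≤ |y| ^ s := by positivity
    have h3 : ((Nat.succ 3 : ℕ) : ℝ) * (((3 : ℕ).factorial * (3 : ℕ) : ℝ))⁻¹ ≤ 4 := by
      norm_num [Nat.factorial]
    calc _ ≤ |y| ^ 3 * 4 := by gcongr
      _ ≤ _ := by linarith
  · have h1 : |y| ^ 2 ≤ |y| ^ s := by
      rw [← Real.rpow_natCast]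
      exact Real.rpow_le_rpow_of_exponent_le h (by exact_mod_cast hs)
    have h2 : ‖Complex.exp (y * Complex.I)‖ = 1 := Complex.norm_exp_ofReal_mul_I y
    have h3 : ‖(1 + y * Complex.I - (y : ℂ) ^ 2 / 2)‖ ≤ 1 + |y| + |y| ^ 2 / 2 := by
      refine (norm_sub_le _ _).trans (add_le_add ((norm_add_le _ _).trans ?_) ?_)
      · simp
      · simp
    refine (norm_sub_le _ _).trans ?_
    rw [h2]
    nlinarith

lemma norm_charFun_map_sub_taylor_two_le {Ω : Type*} [MeasurableSpace Ω] {Q : Measure Ω}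
    [IsProbabilityMeasure Q] {W : Ω → ℝ} (hW : AEMeasurable W Q) {s : ℝ} (hs : 2 ≤ s) (hs3 : s ≤ 3)
    (hW2 : MemLp W 2 Q)
    (h0 : ∫ ω, W ω ∂Q = 0) (h1 : ∫ ω, W ω ^ 2 ∂Q = 1) (hint : Integrable (fun ω => |W ω| ^ s) Q)
    (t : ℝ) :
    ‖charFun (Q.map W) t - (1 - (t : ℂ) ^ 2 / 2)‖ ≤ 4 * |t| ^ s * ∫ ω, |W ω| ^ s ∂Q := by
  have i1 : Integrable W Q := hW2.integrable (by norm_num)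
  have i2 : Integrable (fun ω => W ω ^ 2) Q := hW2.integrable_sq
  have e1 : charFun (Q.map W) t = ∫ ω, Complex.exp (((t * W ω : ℝ) : ℂ) * Complex.I) ∂Q := by
    rw [charFun_apply_real, integral_map hW (by fun_prop)]
    simp
  have i3 : Integrable (fun ω => ((W ω : ℝ) : ℂ)) Q := i1.ofReal
  have i4 : Integrable (fun ω => ((W ω ^ 2 : ℝ) : ℂ)) Q := i2.ofReal
  have i5 : Integrable (fun ω => (1 + ((t * W ω : ℝ) : ℂ) * Complex.I
      - ((t * W ω : ℝ) : ℂ) ^ 2 / 2)) Q := by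
    have := ((integrable_const (1 : ℂ)).add (i3.const_mul (t * Complex.I))).sub
      (i4.const_mul ((t : ℂ) ^ 2 / 2))
    refine this.congr (ae_of_all _ fun ω => ?_)
    simp; ring
  have e2 : ∫ ω, (1 + ((t * W ω : ℝ) : ℂ) * Complex.I - ((t * W ω : ℝ) : ℂ) ^ 2 / 2) ∂Q
      = 1 - (t : ℂ) ^ 2 / 2 := by
    have : ∀ ω, (1 + ((t * W ω : ℝ) : ℂ) * Complex.I - ((t * W ω : ℝ) : ℂ) ^ 2 / 2)
      = (1 + (t * Complex.I) * ((W ω : ℝ) : ℂ)) - ((t : ℂ) ^ 2 / 2) * ((W ω ^ 2 : ℝ) : ℂ) := by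
      intro ω; push_cast; ring
    simp_rw [this]
    rw [integral_sub (by fun_prop) (by fun_prop), integral_add (by fun_prop) (by fun_prop),
      integral_const_mul, integral_const_mul, integral_complex_ofReal, integral_complex_ofReal, h0, h1]
    simp
  have i6 : Integrable (fun ω => Complex.exp (((t * W ω : ℝ) : ℂ) * Complex.I)) Q := by
    refine Integrable.of_bound (C := 1) (by fun_prop) (ae_of_all _ fun ω => ?_)
    rw [Complex.norm_exp_ofReal_mul_I]
  rw [e1, ← e2, ← integral_sub i6 i5, ← integral_const_mul]
  refine norm_integral_le_of_norm_le (hint.const_mul _) (ae_of_all _ fun ω => ?_)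
  refine (norm_exp_I_mul_sub_taylor_two_le hs hs3 _).trans_eq ?_
  rw [abs_mul, Real.mul_rpow (abs_nonneg _) (abs_nonneg _)]
  ring

/-- **Lyapunov's central limit theorem** for triangular arrays with i.i.d. rows. -/
theorem tendsto_measureReal_sum_div_sqrt_le_of_lyapunov {Ω Ω' : Type*} [MeasurableSpace Ω]
    [MeasurableSpace Ω'] {P : Measure Ω} [IsProbabilityMeasure P] {Q : Measure Ω'}
    [IsProbabilityMeasure Q] {X : ℕ → ℕ → Ω → ℝ} {W : ℕ → Ω' → ℝ} {s : ℝ}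
    (hs : 2 < s) (hs3 : s ≤ 3) (hindep : ∀ n, iIndepFun (X n) P)
    (hident : ∀ n i, IdentDistrib (X n i) (W n) P Q)
    (hW2 : ∀ᶠ n in atTop, MemLp (W n) 2 Q)
    (h0 : ∀ᶠ n in atTop, ∫ ω, W n ω ∂Q = 0) (h1 : ∀ᶠ n in atTop, ∫ ω, W n ω ^ 2 ∂Q = 1)
    (hint : ∀ᶠ n in atTop, Integrable (fun ω => |W n ω| ^ s) Q)
    (hlim : Tendsto (fun n : ℕ => (∫ ω, |W n ω| ^ s ∂Q) * (n : ℝ) ^ (-((s - 2) / 2))) atTop (𝓝 0))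
    (x : ℝ) :
    Tendsto (fun n : ℕ => P.real {ω | (∑ i ∈ Finset.range n, X n i ω) / √n ≤ x}) atTop
      (𝓝 (cdf (gaussianReal 0 1) x)) := by
  have mX n i : AEMeasurable (X n i) P := (hident n i).aemeasurable_fst
  have mS (n : ℕ) : AEMeasurable (fun ω => (√n)⁻¹ * ∑ i ∈ Finset.range n, X n i ω) P :=
    (Finset.aemeasurable_fun_sum _ fun i _ => mX n i).const_mul _
  let ν : ℕ → ProbabilityMeasure ℝ := fun n =>
    ⟨P.map (fun ω => (√n)⁻¹ * ∑ i ∈ Finset.range n, X n i ω), Measure.isProbabilityMeasure_map (mS n)⟩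
  let g : ProbabilityMeasure ℝ := ⟨gaussianReal 0 1, inferInstance⟩
  have hconv : Tendsto ν atTop (𝓝 g) := by
    refine ProbabilityMeasure.tendsto_iff_tendsto_charFun.2 fun t => ?_
    have hch n : charFun (ν n : Measure ℝ) t = (charFun (Q.map (W n)) ((√n)⁻¹ * t)) ^ n := by
      change charFun (P.map _) t = _
      rw [charFun_map_mul_comp, ((hindep n).restrict _).charFun_map_fun_finsetSum_eq_prod
        (fun _ _ => mX n _)]
      · simp [fun i => (hident n i).map_eq]
      · exact Finset.aemeasurable_fun_sum _ fun _ _ => mX n _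
    simp_rw [hch]
    have hg : charFun (g : Measure ℝ) t = Complex.exp (-(t : ℂ) ^ 2 / 2) := by
      change charFun (gaussianReal 0 1) t = _
      simp [charFun_gaussianReal, neg_div]
    rw [hg]
    -- It is enough that `n (φ_n - 1) → -t²/2`, since then `φ_n ^ n → exp(-t²/2)`. The Taylor error
    -- is of order `n · n^{-s/2}` times the `s`-th absolute moment, which is exactly `hlim`.
    have key : Tendsto (fun n : ℕ => (n : ℂ) * (charFun (Q.map (W n)) ((√n)⁻¹ * t) - 1)) atTop
        (𝓝 (-(t : ℂ) ^ 2 / 2)) := by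
      rw [tendsto_iff_norm_sub_tendsto_zero]
      have hlim' := hlim.const_mul (4 * |t| ^ s)
      rw [mul_zero] at hlim'
      refine squeeze_zero' (Eventually.of_forall fun _ => norm_nonneg _) ?_ hlim'
      filter_upwards [hW2, h0, h1, hint, eventually_gt_atTop 0] with n a1 a2 a3 a4 hn
      have hn' : (0 : ℝ) < n := by exact_mod_cast hn
      have hT := norm_charFun_map_sub_taylor_two_le (hident n 0).aemeasurable_snd hs.le hs3 a1 a2 a3
        a4 ((√n)⁻¹ * t)
      have hsq : ((((√(n : ℝ))⁻¹ * t : ℝ)) : ℂ) ^ 2 = (t : ℂ) ^ 2 / n := by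
        rw [← Complex.ofReal_pow, mul_pow, inv_pow, Real.sq_sqrt hn'.le]
        push_cast; field_simp
      have hnC : (n : ℂ) ≠ 0 := by exact_mod_cast hn.ne'
      have e1 : (n : ℂ) * (charFun (Q.map (W n)) ((√n)⁻¹ * t) - 1) - (-(t : ℂ) ^ 2 / 2)
          = n * (charFun (Q.map (W n)) ((√n)⁻¹ * t) -
            (1 - ((((√(n : ℝ))⁻¹ * t : ℝ)) : ℂ) ^ 2 / 2)) := by
        rw [hsq]; field_simp; ring
      rw [e1, norm_mul]
      have e2 : |(√(n : ℝ))⁻¹ * t| ^ s = (n : ℝ) ^ (-(s / 2)) * |t| ^ s := by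
        rw [abs_mul, Real.mul_rpow (abs_nonneg _) (abs_nonneg _), abs_of_nonneg (by positivity),
          Real.sqrt_eq_rpow, ← Real.rpow_neg hn'.le, ← Real.rpow_mul hn'.le]
        congr 2; ring
      have e3 : (n : ℝ) ^ (-((s - 2) / 2)) = n * (n : ℝ) ^ (-(s / 2)) := by
        rw [← Real.rpow_one_add' hn'.le (by linarith)]
        congr 1; ring
      rw [e2] at hT
      rw [e3]
      calc _ ≤ (n : ℝ) * (4 * ((n : ℝ) ^ (-(s / 2)) * |t| ^ s) * ∫ ω, |W n ω| ^ s ∂Q) := by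
            rw [Complex.norm_natCast]
            gcongr
        _ = _ := by ring
    have := Complex.tendsto_one_add_pow_exp_of_tendsto key
    simpa using this
  have hnull : (g : Measure ℝ) (frontier (Iic x)) = 0 := by
    have : NullSingletonClass (gaussianReal 0 1) := nullSingletonClass_gaussianReal one_ne_zero
    change gaussianReal 0 1 (frontier (Iic x)) = 0
    rw [frontier_Iic]
    exact measure_singleton x
  have h2 := ProbabilityMeasure.tendsto_measure_of_null_frontier_of_tendsto' hconv hnull
  have h3 := (ENNReal.tendsto_toReal (measure_ne_top _ _)).comp h2
  rw [cdf_eq_real]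
  refine h3.congr fun n => ?_
  change (P.map _ (Iic x)).toReal = _
  rw [Measure.map_apply_of_aemeasurable (mS n) measurableSet_Iic, measureReal_def]
  congr 2
  ext ω
  simp [div_eq_inv_mul]

/-! ### Quantiles and Potter-type bounds. -/

/-- Right continuity makes the infimum attained. The limits of the cdf at `±∞` make the set nonempty
and bounded below, so `sInf` is not a default value. -/
lemma quantile_cdf_le_iff (μ : Measure ℝ) [IsProbabilityMeasure μ] {s : ℝ} (hs0 : 0 < s)
    (hs1 : s < 1) (y : ℝ) : quantile (cdf μ) s ≤ y ↔ s ≤ cdf μ y := by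
  have hne : {x : ℝ | s ≤ cdf μ x}.Nonempty :=
    ((tendsto_cdf_atTop μ).eventually_const_le hs1).exists
  constructor
  · intro h
    by_contra! hlt
    have hr : Tendsto (cdf μ) (𝓝[>] y) (𝓝 (cdf μ y)) :=
      ((cdf μ).right_continuous y).tendsto.mono_left (nhdsWithin_mono _ Ioi_subset_Ici_self)
    obtain ⟨z, hz, hyz⟩ := ((hr.eventually_lt_const hlt).and self_mem_nhdsWithin).exists
    have hz' : z ≤ quantile (cdf μ) s := le_csInf hne fun w hw => by
      by_contra! hwz
      exact absurd ((monotone_cdf μ hwz.le).trans_lt hz) (not_lt.2 hw)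
    exact absurd (hz'.trans h) (not_le.2 hyz)
  · intro h
    refine csInf_le ?_ h
    obtain ⟨z, hz⟩ := ((tendsto_cdf_atBot μ).eventually_lt_const hs0).exists
    refine ⟨z, fun w hw => ?_⟩
    by_contra! hwz
    exact absurd ((monotone_cdf μ hwz.le).trans_lt hz) (not_lt.2 hw)

lemma tail_iterate_bounds {G : ℝ → ℝ} {x₀ c d : ℝ} (hx₀ : 0 < x₀) (hc : 0 < c) (hd : 0 < d)
    (h : ∀ x, x₀ ≤ x → c * G x ≤ G (Real.exp 1 * x) ∧ G (Real.exp 1 * x) ≤ d * G x)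
    (k : ℕ) {x : ℝ} (hx : x₀ ≤ x) :
    c ^ k * G x ≤ G (Real.exp k * x) ∧ G (Real.exp k * x) ≤ d ^ k * G x := by
  induction k with
  | zero => simp
  | succ k ih =>
    have h1 : x₀ ≤ Real.exp k * x :=
      hx.trans (le_mul_of_one_le_left (hx₀.le.trans hx) (Real.one_le_exp (by positivity)))
    have h2 : Real.exp ((k + 1 : ℕ) : ℝ) * x = Real.exp 1 * (Real.exp k * x) := by
      rw [← mul_assoc, ← Real.exp_add]; push_cast; ring_nf
    obtain ⟨h3, h4⟩ := h _ h1
    rw [h2]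
    constructor
    · calc c ^ (k + 1) * G x = c * (c ^ k * G x) := by ring
        _ ≤ c * G (Real.exp k * x) := by gcongr; exact ih.1
        _ ≤ _ := h3
    · calc _ ≤ d * G (Real.exp k * x) := h4
        _ ≤ d * (d ^ k * G x) := by gcongr; exact ih.2
        _ = _ := by ring

/-- Slow variation is used only for the dilation `t = e`; iterating this single step replaces
Potter's theorem, at the cost of rounding exponents to integers. -/
lemma tendsto_tail_ratio {G L : ℝ → ℝ} {γ : ℝ} (hL : IsSlowlyVarying L)
    (hG : ∀ᶠ x : ℝ in atTop, G x = x ^ (-1 / γ) * L x) :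
    (∀ᶠ x in atTop, 0 < G x) ∧
      Tendsto (fun x => G (Real.exp 1 * x) / G x) atTop (𝓝 (Real.exp (-1 / γ))) := by
  obtain ⟨-, hpos, hlim⟩ := hL
  refine ⟨?_, ?_⟩
  · filter_upwards [hG, hpos, eventually_gt_atTop 0] with x h1 h2 h3
    rw [h1]; positivity
  · have h := (hlim _ (Real.exp_pos 1)).const_mul (Real.exp (-1 / γ))
    rw [mul_one] at h
    refine h.congr' ?_
    have hs : Tendsto (fun x : ℝ => Real.exp 1 * x) atTop atTop :=
      tendsto_id.const_mul_atTop (Real.exp_pos 1)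
    filter_upwards [hG, hs.eventually hG, hpos, eventually_gt_atTop 0] with x h1 h2 h3 h4
    rw [h1, h2, Real.mul_rpow (Real.exp_pos 1).le h4.le, ← Real.exp_mul, one_mul]
    have : x ^ (-1 / γ) ≠ 0 := by positivity
    field_simp

/-- Potter-type bounds for the log-ratios of upper quantiles. -/
theorem exists_Yvar_bounds (μ : Measure ℝ) [IsProbabilityMeasure μ] {γ a b : ℝ} {L : ℝ → ℝ}
    (hL : IsSlowlyVarying L) (hF : ∀ᶠ x : ℝ in atTop, 1 - cdf μ x = x ^ (-1 / γ) * L x)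
    (hb : 0 < b) (hbγ : b < γ) (haγ : γ < a) :
    ∃ v₀ : ℝ, 0 < v₀ ∧ v₀ < 1 ∧ (∀ v ∈ Ioc (0 : ℝ) v₀, 0 < quantile (cdf μ) (1 - v)) ∧
      ∀ v ∈ Icc (0 : ℝ) v₀, ∀ u ∈ Ioo (0 : ℝ) 1, 0 ≤ Yvar (cdf μ) γ v u ∧
        b * -Real.log u - 1 ≤ Yvar (cdf μ) γ v u ∧ Yvar (cdf μ) γ v u ≤ a * -Real.log u + 1 := by
  have hγ : 0 < γ := hb.trans hbγ
  have ha : 0 < a := hγ.trans haγ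
  obtain ⟨hpos, hlim⟩ := tendsto_tail_ratio (G := fun x => 1 - cdf μ x) hL hF
  have hc : Real.exp (-1 / b) < Real.exp (-1 / γ) := by
    rw [Real.exp_lt_exp, neg_div, neg_div, neg_lt_neg_iff]
    exact one_div_lt_one_div_of_lt hb hbγ
  have hd : Real.exp (-1 / γ) < Real.exp (-1 / a) := by
    rw [Real.exp_lt_exp, neg_div, neg_div, neg_lt_neg_iff]
    exact one_div_lt_one_div_of_lt hγ haγ
  obtain ⟨x₀, hx₀⟩ := eventually_atTop.1 (hpos.and ((hlim.eventually_const_lt hc).and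
    ((hlim.eventually_lt_const hd).and (eventually_gt_atTop 0))))
  have hx0 : 0 < x₀ := (hx₀ x₀ le_rfl).2.2.2
  have hG0 := (hx₀ x₀ le_rfl).1
  have hstep : ∀ x, x₀ ≤ x →
      Real.exp (-1 / b) * (1 - cdf μ x) ≤ 1 - cdf μ (Real.exp 1 * x) ∧
        1 - cdf μ (Real.exp 1 * x) ≤ Real.exp (-1 / a) * (1 - cdf μ x) := by
    intro x hx
    obtain ⟨h1, h2, h3, -⟩ := hx₀ x hx
    exact ⟨((lt_div_iff₀ h1).1 h2).le, ((div_lt_iff₀ h1).1 h3).le⟩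
  have hiter := fun (k : ℕ) {x : ℝ} (hx : x₀ ≤ x) =>
    tail_iterate_bounds (G := fun x => 1 - cdf μ x) hx0 (Real.exp_pos _) (Real.exp_pos _) hstep k hx
  -- Halving makes `v < 1 - F(x₀)` strict, which forces `Q(1 - v) > x₀`, into the range of the
  -- one-step bounds.
  refine ⟨min ((1 - cdf μ x₀) / 2) (1 / 2), by positivity,
    (min_le_right _ _).trans_lt (by norm_num), ?_⟩
  have hquant : ∀ v ∈ Ioc (0 : ℝ) (min ((1 - cdf μ x₀) / 2) (1 / 2)),
      x₀ < quantile (cdf μ) (1 - v) := by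
    rintro v ⟨hv0, hv⟩
    have hv1 : v ≤ 1 / 2 := hv.trans (min_le_right _ _)
    have hv2 : v ≤ (1 - cdf μ x₀) / 2 := hv.trans (min_le_left _ _)
    rw [← not_le, quantile_cdf_le_iff μ (by linarith) (by linarith)]
    linarith
  refine ⟨fun v hv => hx0.trans (hquant v hv), ?_⟩
  rintro v ⟨hv0, hv⟩ u ⟨hu0, hu1⟩
  have hE : 0 < -Real.log u := by linarith [Real.log_neg hu0 hu1]
  rcases hv0.eq_or_lt with rfl | hv0
  · simp only [Yvar, if_true]
    refine ⟨by nlinarith, by nlinarith, by nlinarith⟩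
  have hxx := hquant v ⟨hv0, hv⟩
  have hv1 : v ≤ 1 / 2 := hv.trans (min_le_right _ _)
  have huv : u * v < v := by nlinarith
  have huv0 : 0 < u * v := by positivity
  simp only [Yvar, if_neg hv0.ne']
  set x := quantile (cdf μ) (1 - v) with hxdef
  set y := quantile (cdf μ) (1 - u * v) with hydef
  have hxpos : 0 < x := hx0.trans hxx
  have hyle : ∀ z, y ≤ z ↔ 1 - cdf μ z ≤ u * v := fun z => by
    rw [hydef, quantile_cdf_le_iff μ (by linarith) (by linarith)]
    constructor <;> intro h <;> linarith
  have hxle : ∀ z, x ≤ z ↔ 1 - cdf μ z ≤ v := fun z => by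
    rw [hxdef, quantile_cdf_le_iff μ (by linarith) (by linarith)]
    constructor <;> intro h <;> linarith
  -- The integer rounding here and in `hlower` is the source of the additive `±1` in the bounds.
  have hupper : y ≤ Real.exp (⌈a * -Real.log u⌉₊ : ℝ) * x := by
    rw [hyle]
    refine (hiter _ hxx.le).2.trans ?_
    have h1 : Real.exp (-1 / a) ^ ⌈a * -Real.log u⌉₊ ≤ u := by
      rw [← Real.exp_nat_mul]
      conv_rhs => rw [← Real.exp_log hu0]
      rw [Real.exp_le_exp, mul_div_assoc', div_le_iff₀ ha]
      linarith [Nat.le_ceil (a * -Real.log u)]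
    have h2 : 1 - cdf μ x ≤ v := (hxle x).1 le_rfl
    have h3 : 0 ≤ 1 - cdf μ x := by linarith [cdf_le_one μ x]
    gcongr
  have hlower : Real.exp (⌊b * -Real.log u⌋₊ : ℝ) * x ≤ y := by
    by_contra! hlt
    set e := Real.exp (⌊b * -Real.log u⌋₊ : ℝ) with he
    have hepos : 0 < e := Real.exp_pos _
    have h1 : u ≤ Real.exp (-1 / b) ^ ⌊b * -Real.log u⌋₊ := by
      rw [← Real.exp_nat_mul]
      conv_lhs => rw [← Real.exp_log hu0]
      rw [Real.exp_le_exp, mul_div_assoc', le_div_iff₀ hb]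
      linarith [Nat.floor_le (mul_pos hb hE).le]
    -- `F` may jump at `x`, so the tail exceeds `v` only strictly to the left of `x`. The maximum
    -- with `x₀` keeps the chosen point within the range of `hiter`.
    have h2 : max (y / e) x₀ < x := max_lt (by rw [div_lt_iff₀ hepos]; linarith) hxx
    have h3 : v < 1 - cdf μ (max (y / e) x₀) := by
      rw [← not_le, ← hxle, not_le]; exact h2
    have h4 := (hiter ⌊b * -Real.log u⌋₊ (le_max_right (y / e) x₀)).1
    have h5 : y ≤ e * max (y / e) x₀ := by
      rw [← div_le_iff₀' hepos]; exact le_max_left _ _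
    have h6 := (hyle _).1 h5
    have h7 : u * v < Real.exp (-1 / b) ^ ⌊b * -Real.log u⌋₊ * (1 - cdf μ (max (y / e) x₀)) :=
      mul_lt_mul' h1 h3 hv0.le (by positivity)
    simp only [← he] at h4
    linarith
  have hypos : 0 < y := lt_of_lt_of_le (by positivity) hlower
  have hlog1 : (⌊b * -Real.log u⌋₊ : ℝ) ≤ Real.log (y / x) := by
    rw [Real.le_log_iff_exp_le (by positivity), le_div_iff₀ hxpos]
    exact hlower
  have hlog2 : Real.log (y / x) ≤ (⌈a * -Real.log u⌉₊ : ℝ) := by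
    rw [Real.log_le_iff_le_exp (by positivity), div_le_iff₀ hxpos]
    exact hupper
  refine ⟨(Nat.cast_nonneg _).trans hlog1, ?_, ?_⟩
  · linarith [Nat.lt_floor_add_one (b * -Real.log u)]
  · linarith [Nat.ceil_lt_add_one (mul_pos ha hE).le]

/-! ### Moments of variables comparable to an exponential one. -/

lemma isProbabilityMeasure_unif : IsProbabilityMeasure unif := ⟨by simp [unif]⟩

lemma ae_unif_mem : ∀ᵐ u ∂unif, u ∈ Ioo (0 : ℝ) 1 := ae_restrict_mem measurableSet_Ioo

lemma unif_real_Ioo {u : ℝ} (hu0 : 0 ≤ u) (hu1 : u ≤ 1) : unif.real (Ioo 0 u) = u := by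
  rw [measureReal_def, unif, Measure.restrict_apply measurableSet_Ioo,
    inter_eq_left.2 (Ioo_subset_Ioo_right hu1)]
  simp [hu0]

lemma integrable_rpow_neg_unif {θ : ℝ} (hθ : θ < 1) : Integrable (fun u : ℝ => u ^ (-θ)) unif := by
  have h := intervalIntegral.intervalIntegrable_rpow' (a := 0) (b := 1) (r := -θ) (by linarith)
  rw [intervalIntegrable_iff_integrableOn_Ioo_of_le zero_le_one] at h
  exact h

lemma integral_rpow_neg_unif {θ : ℝ} (hθ : θ < 1) : ∫ u : ℝ, u ^ (-θ) ∂unif = 1 / (1 - θ) := by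
  rw [unif, ← integral_Ioc_eq_integral_Ioo, ← intervalIntegral.integral_of_le zero_le_one,
    integral_rpow (Or.inl (by linarith))]
  rw [Real.one_rpow, Real.zero_rpow (by linarith)]
  congr 1 <;> ring

/-- The maximum of `w^q exp(-θ w)` is at `w = q / θ`; it is bounded through `1 + z ≤ exp z` with `z
= θ w / q - 1`. -/
lemma rpow_le_mul_exp {w q θ : ℝ} (hw : 0 ≤ w) (hq : 0 < q) (hθ : 0 < θ) :
    w ^ q ≤ (q / (θ * Real.exp 1)) ^ q * Real.exp (θ * w) := by
  have h1 : w ≤ q / (θ * Real.exp 1) * Real.exp (θ * w / q) := by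
    have h := Real.add_one_le_exp (θ * w / q - 1)
    rw [sub_add_cancel, Real.exp_sub] at h
    calc w = q / θ * (θ * w / q) := by field_simp
      _ ≤ q / θ * (Real.exp (θ * w / q) / Real.exp 1) := by gcongr
      _ = _ := by field_simp
  calc w ^ q ≤ (q / (θ * Real.exp 1) * Real.exp (θ * w / q)) ^ q := by gcongr
    _ = _ := by
      rw [Real.mul_rpow (by positivity) (by positivity), ← Real.exp_mul]
      congr 2; field_simp

/-- `f u` lies between affine functions of `-log u`, with slopes `b` and `a`, for `u ∈ (0,1)`. -/
def LogBounds (a b : ℝ) (f : ℝ → ℝ) : Prop :=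
  ∀ u ∈ Ioo (0 : ℝ) 1, 0 ≤ f u ∧ b * -Real.log u - 1 ≤ f u ∧ f u ≤ a * -Real.log u + 1

namespace LogBounds

variable {a b : ℝ} {f : ℝ → ℝ}

lemma rpow_le (hf : LogBounds a b f) (ha : 0 < a) {q θ : ℝ} (hq : 0 < q) (hθ : 0 < θ) {u : ℝ}
    (hu : u ∈ Ioo (0 : ℝ) 1) :
    f u ^ q ≤ (a * q / (θ * Real.exp 1)) ^ q * Real.exp (θ / a) * u ^ (-θ) := by
  obtain ⟨h0, -, h2⟩ := hf u hu
  have hE : 0 < -Real.log u := by linarith [Real.log_neg hu.1 hu.2]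
  calc f u ^ q ≤ (a * (-Real.log u + 1 / a)) ^ q := by
        gcongr; refine h2.trans_eq ?_; field_simp
    _ = a ^ q * (-Real.log u + 1 / a) ^ q := Real.mul_rpow ha.le (by positivity)
    _ ≤ a ^ q * ((q / (θ * Real.exp 1)) ^ q * Real.exp (θ * (-Real.log u + 1 / a))) := by
        gcongr; exact rpow_le_mul_exp (by positivity) hq hθ
    _ = _ := by
        rw [mul_div_assoc, Real.mul_rpow ha.le (by positivity), Real.rpow_def_of_pos hu.1,
          mul_assoc, mul_assoc, ← Real.exp_add]
        congr 3; ring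

lemma integrable_rpow (hf : LogBounds a b f) (ha : 0 < a) (hm : AEMeasurable f unif) {q : ℝ}
    (hq : 0 < q) : Integrable (fun u => f u ^ q) unif := by
  refine ((integrable_rpow_neg_unif (θ := 1 / 2) (by norm_num)).const_mul
    ((a * q / (1 / 2 * Real.exp 1)) ^ q * Real.exp (1 / 2 / a))).mono'
    (hm.pow_const q).aestronglyMeasurable ?_
  filter_upwards [ae_unif_mem] with u hu
  rw [Real.norm_of_nonneg (Real.rpow_nonneg (hf u hu).1 _)]
  exact hf.rpow_le ha hq (by norm_num) hu

lemma integral_rpow_le (hf : LogBounds a b f) (ha : 0 < a) (hm : AEMeasurable f unif) {q θ : ℝ}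
    (hq : 0 < q) (hθ : 0 < θ) (hθ1 : θ < 1) :
    ∫ u, f u ^ q ∂unif ≤ Real.exp (θ / a) / (1 - θ) * (a * q / (θ * Real.exp 1)) ^ q := by
  calc ∫ u, f u ^ q ∂unif
      ≤ ∫ u, (a * q / (θ * Real.exp 1)) ^ q * Real.exp (θ / a) * u ^ (-θ) ∂unif := by
        refine integral_mono_ae (hf.integrable_rpow ha hm hq)
          ((integrable_rpow_neg_unif hθ1).const_mul _) ?_
        filter_upwards [ae_unif_mem] with u hu using hf.rpow_le ha hq hθ hu
    _ = _ := by
        rw [integral_const_mul, integral_rpow_neg_unif hθ1]; ring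

lemma lt_of_lt_exp (hf : LogBounds a b f) (hb : 0 < b) {M u : ℝ} (hM : 0 ≤ M) (hu0 : 0 < u)
    (hu : u < Real.exp (-((M + 1) / b))) : M < f u := by
  have h1 : Real.log u < -((M + 1) / b) := (Real.log_lt_iff_lt_exp hu0).2 hu
  have h2 : u < 1 := hu.trans_le (Real.exp_le_one_iff.2 (by simp; positivity))
  have h3 : M + 1 < b * -Real.log u := by
    rw [← div_lt_iff₀' hb]; linarith
  linarith [(hf u ⟨hu0, h2⟩).2.1]

/-- The integral is restricted to the event `-log u > q + 1 / b`, where `f > b q`. This is where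
`w^q exp(-w)` peaks, so only subexponential factors and the ratio `b` to `γ` are lost. -/
lemma le_integral_rpow (hf : LogBounds a b f) (ha : 0 < a) (hb : 0 < b)
    (hm : AEMeasurable f unif) {q : ℝ} (hq : 0 < q) :
    Real.exp (-(1 / b)) * (b * q / Real.exp 1) ^ q ≤ ∫ u, f u ^ q ∂unif := by
  have hi := hf.integrable_rpow ha hm hq
  have := isProbabilityMeasure_unif
  set u₀ := Real.exp (-((b * q + 1) / b)) with hu₀
  have hu1 : u₀ ≤ 1 := Real.exp_le_one_iff.2 (by simp; positivity)
  calc _ = (b * q) ^ q * u₀ := by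
        rw [Real.div_rpow (by positivity) (by positivity), ← Real.exp_mul, one_mul, hu₀, add_div,
          mul_div_cancel_left₀ _ hb.ne', neg_add, Real.exp_add, Real.exp_neg q]
        ring
    _ = ∫ u in Ioo 0 u₀, (b * q) ^ q ∂unif := by
        rw [setIntegral_const, unif_real_Ioo (Real.exp_pos _).le hu1, smul_eq_mul, mul_comm]
    _ ≤ ∫ u in Ioo 0 u₀, f u ^ q ∂unif := by
        refine setIntegral_mono_on (integrable_const _).integrableOn hi.integrableOn
          measurableSet_Ioo fun u hu => ?_
        exact Real.rpow_le_rpow (by positivity)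
          (hf.lt_of_lt_exp hb (by positivity) hu.1 hu.2).le hq.le
    _ ≤ _ := setIntegral_le_integral hi (by
        filter_upwards [ae_unif_mem] with u hu using Real.rpow_nonneg (hf u hu).1 _)

lemma integral_rpow_pos (hf : LogBounds a b f) (ha : 0 < a) (hb : 0 < b)
    (hm : AEMeasurable f unif) {q : ℝ} (hq : 0 < q) : 0 < ∫ u, f u ^ q ∂unif :=
  lt_of_lt_of_le (by positivity) (hf.le_integral_rpow ha hb hm hq)

lemma rpow_rpow_ae (hf : LogBounds a b f) (p q : ℝ) :
    (fun u => (f u ^ p) ^ q) =ᵐ[unif] fun u => f u ^ (q * p) := by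
  filter_upwards [ae_unif_mem] with u hu
  rw [← Real.rpow_mul (hf u hu).1, mul_comm]

lemma memLp_two (hf : LogBounds a b f) (ha : 0 < a) (hm : AEMeasurable f unif) {q : ℝ}
    (hq : 0 < q) : MemLp (fun u => f u ^ q) 2 unif := by
  rw [memLp_two_iff_integrable_sq (hm.pow_const q).aestronglyMeasurable]
  refine (hf.integrable_rpow ha hm (q := 2 * q) (by positivity)).congr ?_
  refine (hf.rpow_rpow_ae q 2).symm.trans (ae_of_all _ fun u => ?_)
  simp

/-- Zero variance would make `f^q` a.e. equal to its mean, but `f` exceeds any level on an interval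
`(0, u₁)` of positive mass. -/
lemma variance_pos (hf : LogBounds a b f) (ha : 0 < a) (hb : 0 < b) (hm : AEMeasurable f unif)
    {q : ℝ} (hq : 0 < q) : 0 < variance (fun u => f u ^ q) unif := by
  have := isProbabilityMeasure_unif
  refine lt_of_le_of_ne (variance_nonneg _ _) fun h => ?_
  have hae := ae_eq_integral_of_variance_eq_zero (hf.memLp_two ha hm hq) h.symm
  set m := ∫ u, f u ^ q ∂unif
  have hm0 : 0 < m := hf.integral_rpow_pos ha hb hm hq
  set u₁ := Real.exp (-((m ^ (1 / q) + 1) / b))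
  have hu1 : u₁ ≤ 1 := Real.exp_le_one_iff.2 (by simp; positivity)
  have hzero : unif (Ioo 0 u₁) = 0 := by
    refine measure_mono_null (fun u hu => ?_) (ae_iff.1 hae)
    have h1 := hf.lt_of_lt_exp hb (by positivity) hu.1 hu.2
    have h2 := Real.rpow_lt_rpow (by positivity) h1 hq
    rw [← Real.rpow_mul hm0.le, one_div_mul_cancel hq.ne', Real.rpow_one] at h2
    exact h2.ne'
  have h3 := unif_real_Ioo (Real.exp_pos _).le hu1
  rw [measureReal_def, hzero] at h3
  exact (Real.exp_pos _).ne h3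

/-- Dividing the upper bound at `t p` by the lower bound at `2 p` raised to `t / 2` cancels the
superexponential factor `p^{t p}`. Used with `t = 1` to compare mean and second moment, and with `t
= s` for Lyapunov's ratio. -/
lemma integral_rpow_mul_le (hf : LogBounds a b f) (ha : 0 < a) (hb : 0 < b)
    (hm : AEMeasurable f unif) {p t θ : ℝ} (hp : 0 < p) (ht : 0 < t) (hθ : 0 < θ) (hθ1 : θ < 1) :
    ∫ u, f u ^ (t * p) ∂unif ≤ Real.exp (θ / a) / (1 - θ) * Real.exp (t / (2 * b)) *
      (a / (b * θ) * (t / 2)) ^ (t * p) * (∫ u, f u ^ (2 * p) ∂unif) ^ (t / 2) := by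
  have h1 := hf.integral_rpow_le ha hm (q := t * p) (by positivity) hθ hθ1
  have h2 := hf.le_integral_rpow ha hb hm (q := 2 * p) (by positivity)
  have h3 := Real.rpow_le_rpow (by positivity) h2 (show 0 ≤ t / 2 by positivity)
  have hθ' : 0 < 1 - θ := by linarith
  refine h1.trans ?_
  refine le_trans (le_of_eq ?_) (mul_le_mul_of_nonneg_left h3 (by positivity))
  rw [Real.mul_rpow (Real.exp_pos (-(1 / b))).le (by positivity), ← Real.exp_mul,
    ← Real.rpow_mul (by positivity)]
  have e1 : Real.exp (t / (2 * b)) * Real.exp (-(1 / b) * (t / 2)) = 1 := by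
    rw [← Real.exp_add, Real.exp_eq_one_iff]; field_simp; ring
  have e2 : 2 * p * (t / 2) = t * p := by ring
  have e3 : (a * (t * p) / (θ * Real.exp 1)) ^ (t * p) =
      (a / (b * θ) * (t / 2)) ^ (t * p) * (b * (2 * p) / Real.exp 1) ^ (t * p) := by
    rw [← Real.mul_rpow (by positivity) (by positivity)]
    congr 1; field_simp
  rw [e2, e3]
  linear_combination (-(Real.exp (θ / a) / (1 - θ) * (a / (b * θ) * (t / 2)) ^ (t * p) *
    (b * (2 * p) / Real.exp 1) ^ (t * p))) * e1

lemma integral_standardized (hf : LogBounds a b f) (ha : 0 < a) (hb : 0 < b)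
    (hm : AEMeasurable f unif) {p : ℝ} (hp : 0 < p) :
    let W := fun u => (f u ^ p - ∫ u, f u ^ p ∂unif) / √(variance (fun u => f u ^ p) unif)
    MemLp W 2 unif ∧ ∫ u, W u ∂unif = 0 ∧ ∫ u, W u ^ 2 ∂unif = 1 := by
  intro W
  have := isProbabilityMeasure_unif
  have hV := hf.variance_pos ha hb hm hp
  have hL := hf.memLp_two ha hm hp
  have hi := hf.integrable_rpow ha hm hp
  refine ⟨?_, ?_, ?_⟩
  · have := (hL.sub (memLp_const (∫ u, f u ^ p ∂unif))).const_mul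
      (√(variance (fun u => f u ^ p) unif))⁻¹
    refine this.ae_eq (ae_of_all _ fun u => ?_)
    simp only [W, Pi.sub_apply]
    rw [div_eq_inv_mul]
  · simp only [W]
    rw [integral_div, integral_sub hi (integrable_const _)]
    simp
  · simp only [W, div_pow]
    rw [integral_div, Real.sq_sqrt hV.le,
      ← variance_eq_integral (hm.pow_const p), div_self hV.ne']

/-- Under `hsmall` the variance is at least half the second moment, so the standard deviation can be
replaced by the latter; centering costs little because `|x - m| ≤ max x m` for nonnegative `x` and
`m`. -/
lemma integral_abs_standardized_rpow_le (hf : LogBounds a b f) (ha : 0 < a) (hb : 0 < b)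
    (hm : AEMeasurable f unif) {p s : ℝ} (hp : 0 < p) (hs : 0 < s)
    (hsmall : (∫ u, f u ^ p ∂unif) ^ 2 ≤ (∫ u, f u ^ (2 * p) ∂unif) / 2) :
    let W := fun u => (f u ^ p - ∫ u, f u ^ p ∂unif) / √(variance (fun u => f u ^ p) unif)
    Integrable (fun u => |W u| ^ s) unif ∧ ∫ u, |W u| ^ s ∂unif ≤ 2 ^ (s / 2) *
      ((∫ u, f u ^ (s * p) ∂unif) / (∫ u, f u ^ (2 * p) ∂unif) ^ (s / 2) + 1) := by
  intro W
  have := isProbabilityMeasure_unif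
  have hV := hf.variance_pos ha hb hm hp
  set m := ∫ u, f u ^ p ∂unif with hmdef
  set M := ∫ u, f u ^ (2 * p) ∂unif with hMdef
  have hm0 : 0 < m := hf.integral_rpow_pos ha hb hm hp
  have hM0 : 0 < M := hf.integral_rpow_pos ha hb hm (by positivity)
  have hVM : M / 2 ≤ variance (fun u => f u ^ p) unif := by
    rw [variance_eq_sub (hf.memLp_two ha hm hp)]
    have : ∫ u, ((fun u => f u ^ p) ^ 2) u ∂unif = M := by
      refine integral_congr_ae (EventuallyEq.trans (ae_of_all _ fun u => ?_) (hf.rpow_rpow_ae p 2))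
      simp
    rw [this]
    linarith
  set V := variance (fun u => f u ^ p) unif
  have hi := (hf.integrable_rpow ha hm (q := s * p) (by positivity)).add
    (integrable_const (m ^ s))
  have hbound : ∀ᵐ u ∂unif, |W u| ^ s ≤ (V ^ (s / 2))⁻¹ * (f u ^ (s * p) + m ^ s) := by
    filter_upwards [ae_unif_mem, hf.rpow_rpow_ae p s] with u hu hus
    have hfu : 0 ≤ f u ^ p := Real.rpow_nonneg (hf u hu).1 _
    have h1 : |f u ^ p - m| ≤ max (f u ^ p) m := by
      rw [abs_le]
      constructor
      · linarith [le_max_right (f u ^ p) m]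
      · linarith [le_max_left (f u ^ p) m]
    have h2 : |f u ^ p - m| ^ s ≤ f u ^ (s * p) + m ^ s := by
      rw [← hus]
      refine (Real.rpow_le_rpow (abs_nonneg _) h1 hs.le).trans ?_
      rcases max_cases (f u ^ p) m with ⟨h, -⟩ | ⟨h, -⟩ <;> rw [h]
      · exact le_add_of_nonneg_right (by positivity)
      · exact le_add_of_nonneg_left (by positivity)
    simp only [W]
    rw [abs_div, Real.div_rpow (abs_nonneg _) (abs_nonneg _), abs_of_nonneg (Real.sqrt_nonneg _),
      Real.sqrt_eq_rpow, ← Real.rpow_mul hV.le, div_eq_inv_mul, one_div_mul_eq_div]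
    gcongr
  have hWm : AEMeasurable W unif := ((hm.pow_const p).sub_const m).div_const _
  have hint : Integrable (fun u => |W u| ^ s) unif := by
    refine (hi.const_mul (V ^ (s / 2))⁻¹).mono'
      ((hWm.abs).pow_const s).aestronglyMeasurable ?_
    filter_upwards [hbound] with u hu
    rw [Real.norm_of_nonneg (by positivity)]
    exact hu
  refine ⟨hint, ?_⟩
  have h3 : ∫ u, |W u| ^ s ∂unif ≤
      (V ^ (s / 2))⁻¹ * ((∫ u, f u ^ (s * p) ∂unif) + m ^ s) := by
    refine (integral_mono_ae hint (hi.const_mul _) hbound).trans_eq ?_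
    rw [integral_const_mul]
    simp only [Pi.add_apply]
    rw [integral_add (hf.integrable_rpow ha hm (by positivity)) (integrable_const _)]
    simp
  have h4 : m ^ s ≤ M ^ (s / 2) := by
    have : m ^ s = (m ^ 2) ^ (s / 2) := by
      rw [← Real.rpow_natCast, ← Real.rpow_mul hm0.le]; congr 1; push_cast; ring
    rw [this]
    gcongr
    linarith
  have h5 : (V ^ (s / 2))⁻¹ ≤ 2 ^ (s / 2) * (M ^ (s / 2))⁻¹ := by
    have : 2 ^ (s / 2) * (M ^ (s / 2))⁻¹ = ((M / 2) ^ (s / 2))⁻¹ := by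
      rw [Real.div_rpow hM0.le (by norm_num), inv_div]; exact (div_eq_mul_inv _ _).symm
    rw [this]
    gcongr
  have h6 : 0 ≤ ∫ u, f u ^ (s * p) ∂unif :=
    (hf.integral_rpow_pos ha hb hm (by positivity)).le
  have h7 : 0 < M ^ (s / 2) := by positivity
  calc _ ≤ _ := h3
    _ ≤ 2 ^ (s / 2) * (M ^ (s / 2))⁻¹ * ((∫ u, f u ^ (s * p) ∂unif) + M ^ (s / 2)) := by gcongr
    _ = _ := by field_simp

end LogBounds

/-! ### Asymptotics along `p n → ∞`. -/

lemma tendsto_rpow_mul_natCast_rpow_neg {p : ℕ → ℝ} (hp : Tendsto p atTop atTop) {β s c : ℝ}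
    (hβ : ∀ᶠ n : ℕ in atTop, β * p n ≤ Real.log n) (hs : 2 < s) (hc : 0 < c)
    (h : s * Real.log c < β * ((s - 2) / 2)) :
    Tendsto (fun n : ℕ => c ^ (s * p n) * (n : ℝ) ^ (-((s - 2) / 2))) atTop (𝓝 0) := by
  have hη : 0 < β * ((s - 2) / 2) - s * Real.log c := by linarith
  have hlim : Tendsto (fun n => Real.exp (-((β * ((s - 2) / 2) - s * Real.log c) * p n))) atTop
      (𝓝 0) :=
    Real.tendsto_exp_neg_atTop_nhds_zero.comp (hp.const_mul_atTop hη)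
  refine squeeze_zero' (Eventually.of_forall fun n => by positivity) ?_ hlim
  filter_upwards [hβ, eventually_gt_atTop 0] with n h1 h2
  have hn : (0 : ℝ) < n := by exact_mod_cast h2
  rw [Real.rpow_def_of_pos hc, Real.rpow_def_of_pos hn, ← Real.exp_add, Real.exp_le_exp]
  have h3 : 0 < (s - 2) / 2 := by linarith
  nlinarith [mul_le_mul_of_nonneg_right h1 h3.le]

/-- By the case `t = 1`, the squared mean over the second moment decays exponentially in `p n`: its
base is below 1 exactly because `a / (b θ) < 2`. -/
lemma eventually_sq_integral_rpow_le {a b θ : ℝ} (ha : 0 < a) (hb : 0 < b) (hθ : 0 < θ)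
    (hθ1 : θ < 1) (hr : a / (b * θ) < 2) {f : ℕ → ℝ → ℝ} (hf : ∀ n, LogBounds a b (f n))
    (hm : ∀ n, AEMeasurable (f n) unif) {p : ℕ → ℝ} (hp : Tendsto p atTop atTop) :
    ∀ᶠ n in atTop, (∫ u, f n u ^ p n ∂unif) ^ 2 ≤ (∫ u, f n u ^ (2 * p n) ∂unif) / 2 := by
  set K := Real.exp (θ / a) / (1 - θ) * Real.exp (1 / (2 * b)) with hK
  have hlim : Tendsto (fun n => (K * (a / (b * θ) * (1 / 2)) ^ (p n)) ^ 2) atTop (𝓝 0) := by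
    have h1 : Tendsto (fun n => (a / (b * θ) * (1 / 2)) ^ (p n)) atTop (𝓝 0) :=
      (tendsto_rpow_atTop_of_base_lt_one _ (by linarith [show 0 < a / (b * θ) by positivity])
        (by linarith)).comp hp
    simpa using (h1.const_mul K).pow 2
  filter_upwards [hlim.eventually_le_const (show (0 : ℝ) < 1 / 2 by norm_num),
    hp.eventually_gt_atTop 0] with n h1 h2
  have h3 := (hf n).integral_rpow_mul_le ha hb (hm n) h2 one_pos hθ hθ1
  rw [one_mul, ← hK, ← Real.sqrt_eq_rpow] at h3
  have hM := (hf n).integral_rpow_pos ha hb (hm n) (q := 2 * p n) (by positivity)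
  have hm0 := (hf n).integral_rpow_pos ha hb (hm n) (q := p n) h2
  calc _ ≤ _ := pow_le_pow_left₀ hm0.le h3 2
    _ = (K * (a / (b * θ) * (1 / 2)) ^ (p n)) ^ 2 * ∫ u, f n u ^ (2 * p n) ∂unif := by
      rw [mul_pow _ (√_), Real.sq_sqrt hM.le]
    _ ≤ 1 / 2 * ∫ u, f n u ^ (2 * p n) ∂unif := by gcongr
    _ = _ := by ring

lemma tendsto_lyapunov_ratio {a b θ β s : ℝ} (ha : 0 < a) (hb : 0 < b) (hθ : 0 < θ)
    (hθ1 : θ < 1) (hs : 2 < s) {f : ℕ → ℝ → ℝ}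
    (hf : ∀ n, LogBounds a b (f n)) (hm : ∀ n, AEMeasurable (f n) unif) {p : ℕ → ℝ}
    (hp : Tendsto p atTop atTop) (hβ : ∀ᶠ n : ℕ in atTop, β * p n ≤ Real.log n)
    (hrate : s * Real.log (a / (b * θ) * (s / 2)) < β * ((s - 2) / 2))
    (hsmall : ∀ᶠ n in atTop,
      (∫ u, f n u ^ p n ∂unif) ^ 2 ≤ (∫ u, f n u ^ (2 * p n) ∂unif) / 2) :
    Tendsto (fun n : ℕ => (∫ u, |(f n u ^ p n - ∫ u, f n u ^ p n ∂unif) /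
      √(variance (fun u => f n u ^ p n) unif)| ^ s ∂unif) * (n : ℝ) ^ (-((s - 2) / 2)))
      atTop (𝓝 0) := by
  set K := Real.exp (θ / a) / (1 - θ) * Real.exp (s / (2 * b)) with hK
  have h1 := tendsto_rpow_mul_natCast_rpow_neg hp hβ hs
    (show 0 < a / (b * θ) * (s / 2) by positivity) hrate
  have h2 : Tendsto (fun n : ℕ => (n : ℝ) ^ (-((s - 2) / 2))) atTop (𝓝 0) :=
    (tendsto_rpow_neg_atTop (by linarith)).comp tendsto_natCast_atTop_atTop
  have hlim := ((h1.const_mul K).add h2).const_mul (2 ^ (s / 2))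
  rw [mul_zero, add_zero, mul_zero] at hlim
  refine squeeze_zero' (Eventually.of_forall fun n => ?_) ?_ hlim
  · exact mul_nonneg (integral_nonneg fun u => by positivity) (by positivity)
  filter_upwards [hsmall, hp.eventually_gt_atTop 0] with n h3 h4
  have h5 := ((hf n).integral_abs_standardized_rpow_le ha hb (hm n) h4
    (show 0 < s by linarith) h3).2
  have h6 := (hf n).integral_rpow_mul_le ha hb (hm n) h4 (show 0 < s by linarith) hθ hθ1
  have hM := (hf n).integral_rpow_pos ha hb (hm n) (q := 2 * p n) (by positivity)
  rw [← hK, ← div_le_iff₀ (by positivity)] at h6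
  calc _ ≤ _ := mul_le_mul_of_nonneg_right h5 (by positivity)
    _ ≤ 2 ^ (s / 2) * (K * (a / (b * θ) * (s / 2)) ^ (s * p n) + 1) *
        (n : ℝ) ^ (-((s - 2) / 2)) := by gcongr
    _ = _ := by ring

/-! ### Uniformity in `v`, choice of parameters, conclusion. -/

/-- A near-maximizer argument: uniform convergence follows from convergence along sequences. -/
lemma tendsto_iSup_of_forall_seq {ι : Type*} [Nonempty ι] {d : ℕ → ι → ℝ} (h0 : ∀ n i, 0 ≤ d n i)
    (h : ∀ w : ℕ → ι, Tendsto (fun n => d n (w n)) atTop (𝓝 0)) :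
    Tendsto (fun n => ⨆ i, d n i) atTop (𝓝 0) := by
  -- No boundedness is needed: an unbounded family has supremum 0 by default, and the choice is
  -- still possible.
  have hw : ∀ n : ℕ, ∃ i, (⨆ i, d n i) - 1 / ((n : ℝ) + 1) < d n i := fun n =>
    exists_lt_of_lt_ciSup (sub_lt_self _ (by positivity))
  choose w hw using hw
  have hlim := (h w).add (tendsto_one_div_add_atTop_nhds_zero_nat (𝕜 := ℝ))
  rw [add_zero] at hlim
  refine squeeze_zero (fun n => Real.iSup_nonneg (h0 n)) (fun n => ?_) hlim
  linarith [hw n]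

lemma exists_rate_parameters {β : ℝ} (hβ : 2 < β) {γ : ℝ} (hγ : 0 < γ) :
    ∃ a b θ s : ℝ, 0 < b ∧ b < γ ∧ γ < a ∧ 0 < θ ∧ θ < 1 ∧ 2 < s ∧ s ≤ 3 ∧ a / (b * θ) < 2 ∧
      s * Real.log (a / (b * θ) * (s / 2)) < β * ((s - 2) / 2) := by
  -- With `s = 2 (1 + e)`, the cap `1 / 2` gives `s ≤ 3` and `(β - 2) / 8` gives `(1 + e)² < β / 2`.
  -- The loss `a / (b θ) = exp(e²)`, shared equally by `a / γ`, `γ / b` and `1 / θ`, is of second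
  -- order against the gain, linear in `e`.
  set e := min (1 / 2) ((β - 2) / 8) with he
  have he0 : 0 < e := lt_min (by norm_num) (by linarith)
  have he1 : e ≤ 1 / 2 := min_le_left _ _
  have he2 : e ≤ (β - 2) / 8 := min_le_right _ _
  have hk : 0 < e ^ 2 / 3 := by positivity
  have hratio : γ * Real.exp (e ^ 2 / 3) / (γ * Real.exp (-(e ^ 2 / 3)) * Real.exp (-(e ^ 2 / 3)))
      = Real.exp (e ^ 2) := by
    rw [mul_assoc, mul_div_mul_left _ _ hγ.ne', ← Real.exp_add, ← Real.exp_sub]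
    congr 1; ring
  have h1 : 1 < Real.exp (e ^ 2 / 3) := Real.one_lt_exp_iff.2 hk
  have h2 : Real.exp (-(e ^ 2 / 3)) < 1 := Real.exp_zero ▸ Real.exp_lt_exp.2 (by linarith)
  refine ⟨γ * Real.exp (e ^ 2 / 3), γ * Real.exp (-(e ^ 2 / 3)), Real.exp (-(e ^ 2 / 3)),
    2 * (1 + e), by positivity, by nlinarith, by nlinarith, by positivity, h2, by linarith,
    by linarith, ?_, ?_⟩
  · rw [hratio, ← Real.lt_log_iff_exp_lt (by norm_num)]
    nlinarith [Real.log_two_gt_d9]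
  · rw [hratio, mul_div_cancel_left₀ _ two_ne_zero, Real.log_mul (by positivity) (by positivity),
      Real.log_exp]
    have h3 : Real.log (1 + e) ≤ e := by linarith [Real.log_le_sub_one_of_pos (show 0 < 1 + e by linarith)]
    have h4 : (1 + e) ^ 2 < β / 2 := by nlinarith
    calc 2 * (1 + e) * (e ^ 2 + Real.log (1 + e)) ≤ 2 * (1 + e) * (e ^ 2 + e) := by gcongr
      _ = 2 * e * (1 + e) ^ 2 := by ring
      _ < 2 * e * (β / 2) := by gcongr
      _ = _ := by ring

theorem mainTheorem8 (μ : Measure ℝ) [IsProbabilityMeasure μ]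
    (γ : ℝ) (hγ : 0 < γ)
    (L : ℝ → ℝ) (hL : IsSlowlyVarying L)
    (hF : ∀ᶠ x : ℝ in atTop, 1 - cdf μ x = x ^ (-1 / γ) * L x)
    {Ω : Type*} [MeasurableSpace Ω] (P : Measure Ω) [IsProbabilityMeasure P]
    (Y : ℝ → ℕ → Ω → ℝ)
    (hindep : ∀ v ∈ Ico (0 : ℝ) 1, iIndepFun (Y v) P)
    (hident : ∀ v ∈ Ico (0 : ℝ) 1, ∀ i : ℕ, IdentDistrib (Y v i) (Yvar (cdf μ) γ v) P unif)
    (α : EReal) (hα : 2 < α) :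
    ∃ v₀ : ℝ, 0 < v₀ ∧ v₀ < 1 ∧
      (∀ v ∈ Ioc (0 : ℝ) v₀, 0 < quantile (cdf μ) (1 - v)) ∧
      (∀ v ∈ Icc (0 : ℝ) v₀, ∀ q : ℝ, 0 < q →
        Integrable (fun u => Yvar (cdf μ) γ v u ^ q) unif ∧ 0 < sigmaMoment (cdf μ) γ q v) ∧
      ∀ p : ℕ → ℝ, Tendsto p atTop atTop →
        liminf (fun n : ℕ => ((Real.log n / p n : ℝ) : EReal)) atTop = α →
        ∀ x : ℝ,
          Tendsto (fun n : ℕ => ⨆ v : Icc (0 : ℝ) v₀,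
            |P.real {ω | (Zsum Y n (p n) v ω - n * mMoment (cdf μ) γ (p n) v) /
                (Real.sqrt n * sigmaMoment (cdf μ) γ (p n) v) ≤ x}
              - cdf (gaussianReal 0 1) x|)
            atTop (𝓝 0) := by
  have := isProbabilityMeasure_unif
  -- A real `β` covers `α = ∞` as well, and fixing it before `p` keeps `v₀` independent of the
  -- sequence.
  obtain ⟨β, hβ2, hβα⟩ := EReal.lt_iff_exists_real_btwn.1 hα
  have hβ : 2 < β := EReal.coe_lt_coe_iff.1 hβ2
  obtain ⟨a, b, θ, s, hb, hbγ, haγ, hθ, hθ1, hs, hs3, hr, hrate⟩ := exists_rate_parameters hβ hγ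
  have ha : 0 < a := hγ.trans haγ
  obtain ⟨v₀, hv0, hv1, hQ, hY⟩ := exists_Yvar_bounds μ hL hF hb hbγ haγ
  have hmem : ∀ v ∈ Icc (0 : ℝ) v₀, v ∈ Ico (0 : ℝ) 1 := fun v hv => ⟨hv.1, hv.2.trans_lt hv1⟩
  have hmeas : ∀ v ∈ Icc (0 : ℝ) v₀, AEMeasurable (Yvar (cdf μ) γ v) unif := fun v hv =>
    (hident v (hmem v hv) 0).aemeasurable_snd
  have hLB : ∀ v ∈ Icc (0 : ℝ) v₀, LogBounds a b (Yvar (cdf μ) γ v) := hY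
  refine ⟨v₀, hv0, hv1, hQ, fun v hv q hq => ⟨(hLB v hv).integrable_rpow ha (hmeas v hv) hq,
    Real.sqrt_pos.2 ((hLB v hv).variance_pos ha hb (hmeas v hv) hq)⟩, fun p hp hlim x => ?_⟩
  have hβp : ∀ᶠ n : ℕ in atTop, β * p n ≤ Real.log n := by
    rw [← hlim] at hβα
    filter_upwards [eventually_lt_of_lt_liminf hβα, hp.eventually_gt_atTop 0] with n h1 h2
    rw [← le_div_iff₀ h2]
    exact_mod_cast h1.le
  have : Nonempty (Icc (0 : ℝ) v₀) := ⟨⟨0, le_rfl, hv0.le⟩⟩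
  refine tendsto_iSup_of_forall_seq (fun _ _ => abs_nonneg _) fun w => ?_
  have hf : ∀ n, LogBounds a b (Yvar (cdf μ) γ (w n)) := fun n => hLB _ (w n).2
  have hm : ∀ n, AEMeasurable (Yvar (cdf μ) γ (w n)) unif := fun n => hmeas _ (w n).2
  have hsmall := eventually_sq_integral_rpow_le ha hb hθ hθ1 hr hf hm hp
  have hlyap := tendsto_lyapunov_ratio ha hb hθ hθ1 hs hf hm hp hβp hrate hsmall
  -- Each summand is standardized by a measurable map of `Y`, so independence and the common law
  -- pass to the triangular array.
  let T : ℕ → ℝ → ℝ := fun n y =>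
    (y ^ p n - mMoment (cdf μ) γ (p n) (w n)) / sigmaMoment (cdf μ) γ (p n) (w n)
  have hT : ∀ n, Measurable (T n) := fun n => by fun_prop
  have hclt := tendsto_measureReal_sum_div_sqrt_le_of_lyapunov (P := P) (Q := unif)
    (X := fun n i ω => T n (Y (w n) i ω)) (W := fun n u => T n (Yvar (cdf μ) γ (w n) u)) hs hs3
    (fun n => (hindep _ (hmem _ (w n).2)).comp _ fun _ => hT n)
    (fun n i => (hident _ (hmem _ (w n).2) i).comp (hT n)) ?_ ?_ ?_ ?_ hlyap x
  · rw [tendsto_iff_norm_sub_tendsto_zero] at hclt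
    refine hclt.congr fun n => ?_
    rw [Real.norm_eq_abs]
    congr 4
    ext ω
    simp only [T, Zsum]
    rw [← Finset.sum_div, Finset.sum_sub_distrib, div_div, mul_comm (√_)]
    simp
  · filter_upwards [hp.eventually_gt_atTop 0] with n hn
    exact ((hf n).integral_standardized ha hb (hm n) hn).1
  · filter_upwards [hp.eventually_gt_atTop 0] with n hn
    exact ((hf n).integral_standardized ha hb (hm n) hn).2.1
  · filter_upwards [hp.eventually_gt_atTop 0] with n hn
    exact ((hf n).integral_standardized ha hb (hm n) hn).2.2
  · filter_upwards [hsmall, hp.eventually_gt_atTop 0] with n h1 hn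
    exact ((hf n).integral_abs_standardized_rpow_le ha hb (hm n) hn (by linarith) h1).1
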